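/- For positive integers $n, m, r$ and a prime $p$, let $$S_n^{(m)}(p^r)=\sum \frac{1}{l_1 l_2\cdots l_n},$$ where the sum is over all ordered $n$-tuples $(l_1,\dots,l_n)$ of positive integers with $l_i<p^r$, $p\nmid l_i$ for all $i$, and $l_1+\cdots+l_n=mp^r$. Let $B_k$ be the Bernoulli numbers, $\frac{t}{e^t-1}=\sum_{k\ge 0}B_k\frac{t^k}{k!}$. For rational numbers $a,b$, write $a\equiv b \pmod{p^k}$ if $a-b=p^kc$ for a rational number $c$ whose reduced denominator is not divisible by $p$. (1) For every $r\ge 1$ and every prime $p>7$, $$S_7^{(1)}(p^{r+1})\equiv -\frac{7!}{10}\,B_{p-7}\,p^r \pmod{p^{r+1}}.$$ (2) For every integer $n\ge 1$, every prime $p>n$ and every $r\ge 2$, $$S_n^{(1)}(p^{r+1})\equiv p\,S_n^{(1)}(p^r) \pmod{p^{r+1}}.$$ -/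

import Mathlib

/-- The set `𝒫_p` of positive integers not divisible by `p`. -/
def pFree (p : ℕ) : Set ℕ := {l | 0 < l ∧ ¬ p ∣ l}

open Classical in
/-- `S_n^{(m)}(p^r)`: the sum of `1 / (l_1 ⋯ l_n)` over all ordered tuples `(l_1, …, l_n)` with
`l_1 + ⋯ + l_n = m p^r`, `l_i < p^r` and `l_i ∈ 𝒫_p`. -/
noncomputable def S (n m p r : ℕ) : ℚ :=
  ∑ l ∈ (Fintype.piFinset fun _ : Fin n => Finset.range (p ^ r)).filter
      (fun l => (∀ i, l i ∈ pFree p) ∧ ∑ i, l i = m * p ^ r),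
    1 / ∏ i, (l i : ℚ)

/-- The congruence `a ≡ b (mod p ^ k)` between rational numbers: `a - b` is `p ^ k` times a
rational number whose reduced denominator is not divisible by `p`, that is, `a - b` lies in
`p ^ k ℤ_(p)`. -/
def CongrModPow (p k : ℕ) (a b : ℚ) : Prop :=
  ∃ c : ℚ, ¬ p ∣ c.den ∧ a - b = (p : ℚ) ^ k * c

/-! Put `f_r = ∑ X^l / l` over `l < p^r` prime to `p`; then `S_n^{(m)}(p^r)` is the coefficient of
`X^(m p^r)` in `f_r^n`. Writing an index below `p^(r+1)` as `i p^r + l` and expanding `1 / (l + i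
p^r)` to first order gives, modulo `p^(r+1)`, `f_(r+1) = g(X^(p^r)) f_r + p^r (...)` with `g = 1 +
... + X^(p-1)`. In the `n`-th power the correction carries a further factor `p`, so the sums at
level `r + 1` are combinations of those at level `r`, weighted by coefficients of `g^n`
(`harmonicCoeff_succ`).

Modulo `p^2`, `(n-1)!` times such a weight is `p` times a function of `a` times a function of `m`
(`factorial_mul_boxCount_modEq`). The passage between levels thus has rank one: from level 2 on, all
sums are fixed multiples of the one with `m = 1`, which is multiplied by `p` at each level
(`pow_dvd_harmonicCoeff_succ_sub_mul`). This is part (2), and it reduces part (1) to `r = 1`.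

For `r = 1` one needs `S_7^{(a)}(p)` modulo `p`, that is, coefficients of the 7th power of the
truncated logarithm `L`. The symmetries `X ↦ 1/X` and `X ↦ 1 - X` express all of them through `a =
1` (`coeff_truncLog_pow_seven`). That one is a nested harmonic sum; interpolation turns it into `∑
s^(p-7) H_s`, with `H_s` the harmonic number, and Faulhaber's formula into `B_(p-7)`
(`exists_bernoulli_harmonic`). -/

section
open Polynomial Finset

/-! ### Generating polynomials and the passage from `p^r` to `p^(r+1)` -/

/-- The generating polynomial `∑ X ^ l / l` over `l < p ^ r` prime to `p`, where `u l` plays the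
role of `1 / l`. -/
noncomputable def harmonicPoly {A : Type*} [CommRing A] (p : ℕ) (u : ℕ → A) (r : ℕ) : A[X] :=
  ∑ l ∈ (range (p ^ r)).filter (fun l => ¬ p ∣ l), monomial l (u l)

/-- The sum of `1 / (l_1 ⋯ l_n)` over `l_1 + ⋯ + l_n = m p ^ r` as a coefficient. -/
noncomputable def harmonicCoeff {A : Type*} [CommRing A] (p : ℕ) (u : ℕ → A) (n m r : ℕ) : A :=
  (harmonicPoly p u r ^ n).coeff (m * p ^ r)

section
variable {A B : Type*} [CommRing A] [CommRing B]

theorem map_harmonicPoly (φ : A →+* B) (p : ℕ) (u : ℕ → A) (r : ℕ) :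
    (harmonicPoly p u r).map φ = harmonicPoly p (fun l => φ (u l)) r := by
  simp [harmonicPoly, Polynomial.map_sum]

theorem map_harmonicCoeff (φ : A →+* B) (p : ℕ) (u : ℕ → A) (n m r : ℕ) :
    φ (harmonicCoeff p u n m r) = harmonicCoeff p (fun l => φ (u l)) n m r := by
  rw [harmonicCoeff, harmonicCoeff, ← map_harmonicPoly, ← Polynomial.map_pow, coeff_map]

theorem coeff_harmonicPoly (p : ℕ) (u : ℕ → A) (r k : ℕ) :
    (harmonicPoly p u r).coeff k = if k < p ^ r ∧ ¬ p ∣ k then u k else 0 := by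
  simp [harmonicPoly, coeff_monomial, Finset.sum_ite_eq']

theorem natDegree_harmonicPoly_le (p : ℕ) (u : ℕ → A) (r : ℕ) :
    (harmonicPoly p u r).natDegree ≤ p ^ r - 1 := by
  refine natDegree_le_iff_coeff_eq_zero.2 fun k hk => ?_
  rw [coeff_harmonicPoly, if_neg (by omega)]

/-- Only exponents of `H` divisible by `q` can complete an exponent of `f(X^q)` to `M q`. -/
theorem coeff_expand_mul_mul {q : ℕ} (hq : 0 < q) (f H : A[X]) (M : ℕ) :
    (expand A q f * H).coeff (M * q) =
      ∑ a ∈ range (M + 1), f.coeff (M - a) * H.coeff (a * q) := by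
  induction f using Polynomial.induction_on' with
  | add f g hf hg => simp [add_mul, hf, hg, sum_add_distrib]
  | monomial k c =>
    rw [expand_monomial, ← C_mul_X_pow_eq_monomial, mul_assoc, coeff_C_mul, coeff_X_pow_mul']
    simp only [coeff_monomial, ite_mul, zero_mul]
    by_cases h : k ≤ M
    · rw [if_pos (by rw [mul_comm k]; rw [mul_comm M]; exact Nat.mul_le_mul_left _ h),
        Finset.sum_eq_single (M - k), if_pos (by omega), Nat.sub_mul]
      · intro b hb hne
        rw [mem_range] at hb
        rw [if_neg (by omega)]
      · intro hb
        rw [mem_range] at hb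
        omega
    · rw [if_neg, mul_zero, Finset.sum_eq_zero]
      · intro b hb
        rw [if_neg (by omega)]
      · intro h'
        exact h (Nat.le_of_mul_le_mul_right h' hq)

theorem add_pow_of_sq_eq_zero (a b : A) (hb : b ^ 2 = 0) (n : ℕ) :
    (a + b) ^ n = a ^ n + n * a ^ (n - 1) * b := by
  induction n with
  | zero => simp
  | succ n ih =>
    rw [pow_succ, ih]
    rcases n with _ | n
    · simp
    · simp only [Nat.add_sub_cancel]
      push_cast
      linear_combination ((n + 1) * a ^ n) * hb

theorem unit_eq_sub_of_add {x y z u v : A} (hv : (y + x) * v = 1) (hu : y * u = 1)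
    (hx : x * x = z) (hz : z = 0) : v = u - x * u ^ 2 := by
  have h : (u - x * u ^ 2) * (y + x) = 1 := by
    subst hx
    linear_combination (1 - x * u) * hu - u ^ 2 * hz
  calc v = (u - x * u ^ 2) * (y + x) * v := by rw [h, one_mul]
    _ = _ := by rw [mul_assoc, hv, mul_one]

variable {p : ℕ} {u : ℕ → A}

theorem harmonicPoly_succ (hp : p.Prime) (hu : ∀ l, ¬ p ∣ l → (l : A) * u l = 1) {r : ℕ}
    (hr : 1 ≤ r) (h0 : (p : A) ^ (r + 1) = 0) :
    harmonicPoly p u (r + 1) =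
      expand A (p ^ r) (∑ i ∈ range p, X ^ i) * harmonicPoly p u r +
        expand A (p ^ r) (X * derivative (∑ i ∈ range p, X ^ i)) *
          (C (-(p : A) ^ r) * harmonicPoly p (fun l => u l ^ 2) r) := by
  have hq : 0 < p ^ r := pow_pos hp.pos r
  have hpq : p ∣ p ^ r := dvd_pow_self p (by omega)
  have key : harmonicPoly p u (r + 1) = ∑ i ∈ range p,
      ∑ l ∈ (range (p ^ r)).filter (fun l => ¬ p ∣ l), monomial (i * p ^ r + l)
        (u (i * p ^ r + l)) := by
    rw [← Finset.sum_product', harmonicPoly]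
    symm
    refine Finset.sum_bij' (fun x _ => x.1 * p ^ r + x.2) (fun l _ => (l / p ^ r, l % p ^ r))
      ?_ ?_ ?_ ?_ ?_
    · rintro ⟨i, l⟩ h
      simp only [mem_product, mem_range, mem_filter] at h ⊢
      refine ⟨?_, ?_⟩
      · rw [pow_succ']
        nlinarith [Nat.mul_le_mul_right (p ^ r) (Nat.succ_le_of_lt h.1)]
      · rw [Nat.dvd_add_right (hpq.mul_left i)]
        exact h.2.2
    · intro l h
      simp only [mem_product, mem_range, mem_filter] at h ⊢
      refine ⟨?_, Nat.mod_lt _ hq, ?_⟩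
      · rw [Nat.div_lt_iff_lt_mul hq, ← pow_succ']
        exact h.1
      · rw [← (Nat.dvd_mod_iff hpq)] at h
        exact h.2
    · rintro ⟨i, l⟩ h
      simp only [mem_product, mem_range, mem_filter] at h
      ext
      · simp only
        rw [mul_comm, Nat.mul_add_div hq, Nat.div_eq_of_lt h.2.1, add_zero]
      · simp only
        rw [mul_comm, Nat.mul_add_mod, Nat.mod_eq_of_lt h.2.1]
    · intro l h
      simp only
      rw [mul_comm, Nat.div_add_mod]
    · intros
      rfl
  rw [key]
  have hd : X * derivative (∑ i ∈ range p, X ^ i : A[X]) = ∑ i ∈ range p, C (i : A) * X ^ i := by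
    rw [derivative_sum, Finset.mul_sum]
    refine Finset.sum_congr rfl fun i _ => ?_
    rcases i with _ | i
    · simp
    · rw [derivative_X_pow, Nat.add_sub_cancel, pow_succ]
      ring
  rw [hd, map_sum, map_sum, Finset.sum_mul, Finset.sum_mul, ← Finset.sum_add_distrib]
  refine Finset.sum_congr rfl fun i _ => ?_
  rw [harmonicPoly, harmonicPoly, Finset.mul_sum, Finset.mul_sum, Finset.mul_sum,
    ← Finset.sum_add_distrib]
  refine Finset.sum_congr rfl fun l hl => ?_
  rw [mem_filter] at hl
  have hval : u (i * p ^ r + l) = u l - (i * (p : A) ^ r) * u l ^ 2 := by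
    -- The square of `i p^r` vanishes because `2r = (r + 1) + (r - 1)` with `r ≥ 1`.
    refine unit_eq_sub_of_add (y := (l : A)) (z := i ^ 2 * ((p : A) ^ (r + 1) * p ^ (r - 1)))
      ?_ (hu l hl.2) ?_ (by rw [h0]; ring)
    · have := hu (i * p ^ r + l) (by rw [Nat.dvd_add_right (hpq.mul_left i)]; exact hl.2)
      push_cast at this
      rw [add_comm]
      exact this
    · rw [← pow_add, show r + 1 + (r - 1) = r + r by omega, pow_add]
      ring
  rw [hval]
  simp only [← C_mul_X_pow_eq_monomial, map_mul, map_pow, expand_X, map_sub, map_neg,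
    map_natCast, pow_add, ← pow_mul]
  rw [mul_comm (p ^ r) i]
  ring

/-- The number of `x ∈ [0, p) ^ n` of sum `k`. -/
noncomputable def boxCount (n p k : ℕ) : ℤ := ((∑ i ∈ range p, X ^ i : ℤ[X]) ^ n).coeff k

theorem coeff_geom_pow (n p k : ℕ) :
    ((∑ i ∈ range p, X ^ i : A[X]) ^ n).coeff k = (boxCount n p k : A) := by
  rw [boxCount, ← eq_intCast (Int.castRingHom A), ← coeff_map]
  simp [Polynomial.map_sum]

theorem harmonicCoeff_eq_zero (hp : p.Prime) {n a r : ℕ} (hn : 1 ≤ n)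
    (ha : a = 0 ∨ n ≤ a) : harmonicCoeff p u n a r = 0 := by
  have hq : 0 < p ^ r := pow_pos hp.pos r
  rcases ha with rfl | ha
  · rw [harmonicCoeff, zero_mul, coeff_zero_eq_eval_zero, eval_pow, ← coeff_zero_eq_eval_zero,
      coeff_harmonicPoly, if_neg (by simp), zero_pow (by omega)]
  · refine coeff_eq_zero_of_natDegree_lt (lt_of_le_of_lt natDegree_pow_le ?_)
    calc n * (harmonicPoly p u r).natDegree ≤ n * (p ^ r - 1) :=
          Nat.mul_le_mul_left _ (natDegree_harmonicPoly_le p u r)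
      _ < n * p ^ r := Nat.mul_lt_mul_of_pos_left (by omega) (by omega)
      _ ≤ a * p ^ r := Nat.mul_le_mul_right _ ha

theorem coeff_harmonicPoly_pow_mul_eq_zero (hp : p.Prime) (v : ℕ → A) {n a r : ℕ} (hn : 1 ≤ n)
    (ha : a = 0 ∨ n ≤ a) :
    (harmonicPoly p u r ^ (n - 1) * harmonicPoly p v r).coeff (a * p ^ r) = 0 := by
  have hq : 0 < p ^ r := pow_pos hp.pos r
  rcases ha with rfl | ha
  · rw [zero_mul, mul_coeff_zero, coeff_harmonicPoly p v, if_neg (by simp), mul_zero]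
  · refine coeff_eq_zero_of_natDegree_lt (lt_of_le_of_lt natDegree_mul_le ?_)
    calc (harmonicPoly p u r ^ (n - 1)).natDegree + (harmonicPoly p v r).natDegree
        ≤ (n - 1) * (p ^ r - 1) + (p ^ r - 1) := Nat.add_le_add (natDegree_pow_le.trans
          (Nat.mul_le_mul_left _ (natDegree_harmonicPoly_le p u r)))
            (natDegree_harmonicPoly_le p v r)
      _ = n * (p ^ r - 1) := by
          obtain ⟨k, rfl⟩ := Nat.exists_eq_add_of_le' hn
          simp [add_mul]
      _ < n * p ^ r := Nat.mul_lt_mul_of_pos_left (by omega) (by omega)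
      _ ≤ a * p ^ r := Nat.mul_le_mul_right _ ha

theorem sum_range_eq_sum_Ico {M n : ℕ} (hM : n ≤ M + 1) (g : ℕ → A)
    (hg : ∀ a, a = 0 ∨ n ≤ a → g a = 0) :
    ∑ a ∈ range (M + 1), g a = ∑ a ∈ Ico 1 n, g a := by
  symm
  refine Finset.sum_subset ?_ fun a _ ha => hg a ?_
  · intro a
    simp only [mem_Ico, mem_range]
    omega
  · simp only [mem_Ico] at ha
    omega

theorem harmonicCoeff_succ (hp : p.Prime) (hu : ∀ l, ¬ p ∣ l → (l : A) * u l = 1) {n m r : ℕ}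
    (hn : 1 ≤ n) (hnp : n < p) (hm : 1 ≤ m) (hr : 1 ≤ r) (h0 : (p : A) ^ (r + 1) = 0)
    (hC : ∀ a ∈ Ico 1 n, (p : ℤ) ∣ boxCount n p (m * p - a)) :
    harmonicCoeff p u n m (r + 1) =
      ∑ a ∈ Ico 1 n, (boxCount n p (m * p - a) : A) * harmonicCoeff p u n a r := by
  have hq : 0 < p ^ r := pow_pos hp.pos r
  have hM : n ≤ m * p + 1 := by nlinarith
  have hsq : (C (-(p : A) ^ r) : A[X]) ^ 2 = 0 := by
    rw [← C_pow, neg_sq, ← pow_mul, show r * 2 = r + 1 + (r - 1) by omega, pow_add, h0, zero_mul,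
      C_0]
  rw [harmonicCoeff, harmonicPoly_succ hp hu hr h0, add_pow_of_sq_eq_zero _ _
    -- The correction term has square zero, so the binomial expansion stops at first order; its
    -- factor `n g^(n-1) g'` is then the derivative of `g^n`.
    (by rw [mul_pow, mul_pow, hsq]; ring)]
  set g : A[X] := ∑ i ∈ range p, X ^ i with hg
  have e1 : (n : A[X]) * (expand A (p ^ r) g * harmonicPoly p u r) ^ (n - 1) *
      (expand A (p ^ r) (X * derivative g) *
        (C (-(p : A) ^ r) * harmonicPoly p (fun l => u l ^ 2) r)) =
      C (-(p : A) ^ r) * (expand A (p ^ r) (X * derivative (g ^ n)) *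
        (harmonicPoly p u r ^ (n - 1) * harmonicPoly p (fun l => u l ^ 2) r)) := by
    rw [derivative_pow]
    simp only [map_mul, map_pow, map_natCast, mul_pow]
    ring
  rw [e1, mul_pow, ← map_pow, coeff_add, coeff_C_mul,
    show m * p ^ (r + 1) = (m * p) * p ^ r by rw [pow_succ']; ring,
    coeff_expand_mul_mul hq, coeff_expand_mul_mul hq,
    sum_range_eq_sum_Ico hM, sum_range_eq_sum_Ico hM, Finset.mul_sum, ← Finset.sum_add_distrib]
  · refine Finset.sum_congr rfl fun a ha => ?_
    have ha' := mem_Ico.1 ha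
    have h1 : m * p - a = (m * p - a - 1) + 1 := by
      have : n ≤ m * p := by nlinarith
      omega
    have h2 : (X * derivative (g ^ n)).coeff (m * p - a) =
        (boxCount n p (m * p - a) : A) * (m * p - a : ℕ) := by
      rw [← coeff_geom_pow, h1, coeff_X_mul, coeff_derivative]
      push_cast
      rfl
    -- The correction is `p^r` times a multiple of a box count, and the box count supplies the
    -- missing factor `p`.
    obtain ⟨c, hc⟩ := hC a ha
    rw [h2, hg, coeff_geom_pow, hc]
    push_cast
    rw [harmonicCoeff]
    linear_combination (-(c : A) * ((m * p - a : ℕ) : A) *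
      (harmonicPoly p u r ^ (n - 1) * harmonicPoly p (fun l => u l ^ 2) r).coeff (a * p ^ r)) * h0
  · intro a ha
    rw [coeff_harmonicPoly_pow_mul_eq_zero hp _ hn ha, mul_zero]
  · intro a ha
    have := harmonicCoeff_eq_zero (u := u) hp (r := r) hn ha
    rw [harmonicCoeff] at this
    rw [this, mul_zero]

end

/-! ### Coefficients of `(1 + ... + X^(p-1))^n` modulo `p^2` -/

theorem coeff_one_sub_X_pow_pow_mul (p n k : ℕ) (W : PowerSeries ℤ) :
    PowerSeries.coeff k ((1 - (PowerSeries.X : PowerSeries ℤ) ^ p) ^ n * W) =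
      ∑ j ∈ range (n + 1), (-1) ^ j * (n.choose j : ℤ) *
        (if p * j ≤ k then PowerSeries.coeff (k - p * j) W else 0) := by
  rw [sub_eq_add_neg, add_comm, add_pow, Finset.sum_mul, map_sum]
  refine Finset.sum_congr rfl fun j _ => ?_
  have h : (-(PowerSeries.X : PowerSeries ℤ) ^ p) ^ j * 1 ^ (n - j) *
      (n.choose j : PowerSeries ℤ) * W =
      PowerSeries.C ((-1) ^ j * (n.choose j : ℤ)) * (PowerSeries.X ^ (p * j) * W) := by
    rw [neg_pow, ← pow_mul]
    simp only [map_mul, map_pow, map_neg, map_one, map_natCast, one_pow]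
    ring
  rw [h, PowerSeries.coeff_C_mul, PowerSeries.coeff_X_pow_mul']

/-- Inclusion-exclusion, read off from `g^n = (1 - X^p)^n (1 - X)^(-n)`. -/
theorem boxCount_eq_sum {n : ℕ} (hn : 1 ≤ n) (p k : ℕ) :
    boxCount n p k = ∑ j ∈ range (n + 1), (-1) ^ j * (n.choose j : ℤ) *
      (if p * j ≤ k then ((n - 1 + (k - p * j)).choose (n - 1) : ℤ) else 0) := by
  obtain ⟨d, rfl⟩ := Nat.exists_eq_add_of_le' hn
  have h1 : ((∑ i ∈ range p, X ^ i : ℤ[X]) : PowerSeries ℤ) * (1 - PowerSeries.X) =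
      1 - PowerSeries.X ^ p := by
    have := congrArg (fun f : ℤ[X] => (f : PowerSeries ℤ)) (geom_sum_mul_neg (X : ℤ[X]) p)
    simpa using this
  have h2 := PowerSeries.mk_add_choose_mul_one_sub_pow_eq_one ℤ d
  have h3 : (((∑ i ∈ range p, X ^ i : ℤ[X]) ^ (d + 1) : ℤ[X]) : PowerSeries ℤ) =
      (1 - PowerSeries.X ^ p) ^ (d + 1) *
        PowerSeries.mk fun n => (Nat.choose (d + n) d : ℤ) := by
    rw [← h1, mul_pow, Polynomial.coe_pow, mul_assoc, mul_comm ((1 - PowerSeries.X) ^ (d + 1)), h2,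
      mul_one]
  rw [boxCount, ← Polynomial.coeff_coe, h3, coeff_one_sub_X_pow_pow_mul]
  simp

/-- `∏ (i - a)` over `0 < i < n`, `i ≠ a`. -/
def punctured (n a : ℕ) : ℤ := ∏ i ∈ (Ico 1 n).erase a, ((i : ℤ) - a)

/-- The coefficient of `y ^ m` in `y (1 - y) ^ (n - 2)`. -/
def levelCoeff (n m : ℕ) : ℤ :=
  -- The subtraction `m - j` is truncated, so terms with `j > m` vanish.
  ∑ j ∈ range (n + 1), (-1) ^ j * (n.choose j : ℤ) * ((m - j : ℕ) : ℤ)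

theorem levelCoeff_eq (q m : ℕ) : levelCoeff (q + 2) (m + 1) = (-1) ^ m * (q.choose m : ℤ) := by
  have h2 := PowerSeries.mk_add_choose_mul_one_sub_pow_eq_one ℤ 1
  have h3 : (1 - (PowerSeries.X : PowerSeries ℤ)) ^ (q + 2) *
      (PowerSeries.X * PowerSeries.mk fun n => (Nat.choose (1 + n) 1 : ℤ)) =
      (1 - PowerSeries.X) ^ q * PowerSeries.X := by
    linear_combination ((1 - (PowerSeries.X : PowerSeries ℤ)) ^ q * PowerSeries.X) * h2
  have e1 := coeff_one_sub_X_pow_pow_mul 1 (q + 2) (m + 1)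
    (PowerSeries.X * PowerSeries.mk fun n => (Nat.choose (1 + n) 1 : ℤ))
  have e2 := coeff_one_sub_X_pow_pow_mul 1 q m 1
  rw [mul_one, pow_one] at e2
  rw [pow_one, h3, PowerSeries.coeff_succ_mul_X, e2] at e1
  rw [levelCoeff]
  have e3 : ∀ j, ((m + 1 - j : ℕ) : ℤ) = if 1 * j ≤ m + 1 then PowerSeries.coeff (m + 1 - 1 * j)
      (PowerSeries.X * PowerSeries.mk fun n => (Nat.choose (1 + n) 1 : ℤ)) else 0 := by
    intro j
    rw [one_mul]
    split_ifs with h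
    · rcases hk : m + 1 - j with _ | k
      · simp
      · simp [PowerSeries.coeff_succ_X_mul, add_comm]
    · rw [Nat.sub_eq_zero_of_le (by omega), Nat.cast_zero]
  simp_rw [e3]
  rw [← e1]
  by_cases hm : m ≤ q
  · rw [Finset.sum_eq_single m]
    · simp
    · intro j _ hj
      rw [one_mul, PowerSeries.coeff_one]
      split_ifs <;> omega
    · intro h
      rw [mem_range] at h
      omega
  · rw [Nat.choose_eq_zero_of_lt (by omega), Finset.sum_eq_zero]
    · simp
    · intro j hj
      rw [mem_range] at hj
      rw [one_mul, PowerSeries.coeff_one]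
      split_ifs <;> omega

theorem levelCoeff_one (q : ℕ) : levelCoeff (q + 2) 1 = 1 := by
  simpa using levelCoeff_eq q 0

theorem punctured_eq (b c : ℕ) :
    punctured (b + c + 2) (b + 1) = (-1) ^ b * (b.factorial * c.factorial : ℕ) := by
  have h : (Ico 1 (b + c + 2)).erase (b + 1) = Ico 1 (b + 1) ∪ Ico (b + 2) (b + c + 2) := by
    ext i
    simp only [mem_erase, mem_Ico, mem_union]
    omega
  rw [punctured, h, Finset.prod_union, Finset.prod_Ico_eq_prod_range,
    Finset.prod_Ico_eq_prod_range, ← Finset.prod_range_add_one_eq_factorial,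
    ← Finset.prod_range_add_one_eq_factorial, ← Finset.prod_range_reflect,
    show b + 1 - 1 = b by omega, show b + c + 2 - (b + 2) = c by omega]
  · push_cast
    rw [← mul_assoc]
    congr 1
    · have hb : (-1 : ℤ) ^ b = ∏ _i ∈ range b, (-1 : ℤ) := by simp
      rw [hb, ← Finset.prod_mul_distrib]
      refine Finset.prod_congr rfl fun i hi => ?_
      rw [mem_range] at hi
      rw [Nat.sub_sub]
      push_cast [Nat.cast_sub (show 1 + i ≤ b by omega)]
      ring
    · refine Finset.prod_congr rfl fun i hi => ?_
      ring
  · rw [Finset.disjoint_left]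
    intro i
    simp only [mem_Ico]
    omega

/-- With `n = q + 2`, each of the `n - 1` terms equals `(n-2)!`: the signs cancel and the factorials
complete the binomial coefficient. This is the trace of the rank-one passage between levels. -/
theorem sum_levelCoeff_mul_punctured (q : ℕ) :
    ∑ a ∈ Ico 1 (q + 2), punctured (q + 2) a * levelCoeff (q + 2) a = ((q + 1).factorial : ℕ) := by
  have h : ∀ a ∈ Ico 1 (q + 2), punctured (q + 2) a * levelCoeff (q + 2) a = (q.factorial : ℤ) := by
    intro a ha
    rw [mem_Ico] at ha
    obtain ⟨b, rfl⟩ := Nat.exists_eq_add_of_le' ha.1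
    obtain ⟨c, rfl⟩ := Nat.exists_eq_add_of_le (show b ≤ q by omega)
    rw [levelCoeff_eq, punctured_eq, ← Nat.choose_mul_factorial_mul_factorial (Nat.le_add_right b c),
      Nat.add_sub_cancel_left]
    push_cast
    have : ((-1 : ℤ) ^ b) * (-1) ^ b = 1 := by rw [← mul_pow]; simp
    linear_combination ((b.factorial : ℤ) * c.factorial * ((b + c).choose b)) * this
  rw [Finset.sum_congr rfl h, sum_const, Nat.card_Ico, Nat.factorial_succ]
  simp

/-- The left side is the product of `k p - a + i` over `0 < i < n`. The factor `i = a` is exactly `k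
p`, so the others matter only modulo `p`. -/
theorem factorial_mul_choose_modEq {n p a k : ℕ} (ha : a ∈ Ico 1 n) (hap : a < p) (hk : 1 ≤ k) :
    ((n - 1).factorial : ℤ) * ((n - 1 + (k * p - a)).choose (n - 1) : ℤ) ≡
      k * (p * punctured n a) [ZMOD p ^ 2] := by
  have hkp : a ≤ k * p := hap.le.trans (Nat.le_mul_of_pos_left p hk)
  have h1 : ((n - 1).factorial : ℤ) * ((n - 1 + (k * p - a)).choose (n - 1) : ℤ) =
      ∏ i ∈ Ico 1 n, ((k : ℤ) * p - a + i) := by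
    rw [← Nat.cast_mul, add_comm (n - 1), ← Nat.ascFactorial_eq_factorial_mul_choose,
      Nat.ascFactorial_eq_prod_range, Finset.prod_Ico_eq_prod_range]
    push_cast [Nat.cast_sub hkp]
    refine Finset.prod_congr rfl fun i _ => ?_
    ring
  rw [h1, ← Finset.mul_prod_erase _ _ ha, punctured, sub_add_cancel]
  have h2 : ∏ i ∈ (Ico 1 n).erase a, ((k : ℤ) * p - a + i) ≡
      ∏ i ∈ (Ico 1 n).erase a, ((i : ℤ) - a) [ZMOD p] := by
    refine Int.ModEq.prod fun i _ => ?_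
    refine (Int.modEq_iff_dvd.2 ⟨-k, ?_⟩)
    ring
  rw [sq, mul_assoc]
  exact (h2.mul_left' (c := (p : ℤ))).mul_left (k : ℤ)

/-- In the inclusion-exclusion sum the `j`-th binomial is linear in `m - j` modulo `p^2`, which
separates the dependence on `a` from that on `m`. -/
theorem factorial_mul_boxCount_modEq {n p a m : ℕ} (ha : a ∈ Ico 1 n) (hap : a < p) (hm : 1 ≤ m) :
    ((n - 1).factorial : ℤ) * boxCount n p (m * p - a) ≡
      p * punctured n a * levelCoeff n m [ZMOD p ^ 2] := by
  have ha' := mem_Ico.1 ha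
  rw [boxCount_eq_sum (by omega), levelCoeff, Finset.mul_sum, Finset.mul_sum]
  refine Int.ModEq.sum fun j _ => ?_
  by_cases hj : j < m
  · have hle : p * j ≤ m * p - a := by
      have : (j + 1) * p ≤ m * p := Nat.mul_le_mul_right _ hj
      rw [add_mul, one_mul, mul_comm j] at this
      omega
    rw [if_pos hle, show m * p - a - p * j = (m - j) * p - a by
      rw [Nat.sub_mul, mul_comm j]; omega]
    have := (factorial_mul_choose_modEq (k := m - j) ha hap (by omega)).mul_left
      ((-1) ^ j * (n.choose j : ℤ))
    convert this using 1 <;> ring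
  · rw [if_neg, Nat.sub_eq_zero_of_le (show m ≤ j by omega)]
    · rw [Nat.cast_zero, mul_zero, mul_zero, mul_zero]
    · have h1 : m * p ≤ j * p := Nat.mul_le_mul_right _ (by omega)
      have h2 : p ≤ m * p := Nat.le_mul_of_pos_left p hm
      rw [mul_comm p]
      omega

theorem dvd_boxCount {n p a m : ℕ} (hp : p.Prime) (hnp : n < p) (ha : a ∈ Ico 1 n) (hm : 1 ≤ m) :
    (p : ℤ) ∣ boxCount n p (m * p - a) := by
  have ha' := mem_Ico.1 ha
  have h := (factorial_mul_boxCount_modEq ha (by omega : a < p) hm).dvd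
  have h1 : (p : ℤ) ∣ ((n - 1).factorial : ℤ) * boxCount n p (m * p - a) := by
    have h2 := (dvd_pow_self (p : ℤ) two_ne_zero).trans h
    rw [mul_assoc (p : ℤ)] at h2
    exact (dvd_sub_right (dvd_mul_right _ _)).1 h2
  refine (Prime.dvd_or_dvd (Nat.prime_iff_prime_int.1 hp) h1).resolve_left fun h3 => ?_
  rw [Int.natCast_dvd_natCast, hp.dvd_factorial] at h3
  omega

/-! ### Congruences between consecutive levels -/

section
variable {A : Type*} [CommRing A] {p : ℕ} {u : ℕ → A}

theorem isUnit_factorial_of_lt (hu : ∀ l, ¬ p ∣ l → (l : A) * u l = 1) {k : ℕ} (hk : k < p) :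
    IsUnit ((k.factorial : ℕ) : A) := by
  induction k with
  | zero => simp
  | succ k ih =>
    rw [Nat.factorial_succ, Nat.cast_mul]
    refine IsUnit.mul (IsUnit.of_mul_eq_one _ (hu (k + 1) ?_)) (ih (by omega))
    exact Nat.not_dvd_of_pos_of_lt (by omega) hk

/-- This is `harmonicCoeff_succ` in the quotient of `A` by `p^(r+1)`. -/
theorem pow_dvd_harmonicCoeff_succ_sub (hp : p.Prime) (hu : ∀ l, ¬ p ∣ l → (l : A) * u l = 1)
    {n m r : ℕ} (hn : 1 ≤ n) (hnp : n < p) (hm : 1 ≤ m) (hr : 1 ≤ r) :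
    (p : A) ^ (r + 1) ∣ harmonicCoeff p u n m (r + 1) -
      ∑ a ∈ Ico 1 n, (boxCount n p (m * p - a) : A) * harmonicCoeff p u n a r := by
  rw [← Ideal.mem_span_singleton, ← Ideal.Quotient.eq_zero_iff_mem, map_sub, sub_eq_zero,
    map_harmonicCoeff, map_sum, harmonicCoeff_succ hp ?_ hn hnp hm hr ?_
      (fun a ha => dvd_boxCount hp hnp ha hm)]
  · refine Finset.sum_congr rfl fun a _ => ?_
    rw [map_mul, map_harmonicCoeff, map_intCast]
  · intro l hl
    rw [← map_natCast (Ideal.Quotient.mk _), ← map_mul, hu l hl, map_one]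
  · rw [← map_natCast (Ideal.Quotient.mk _), ← map_pow, Ideal.Quotient.eq_zero_iff_mem]
    exact Ideal.mem_span_singleton_self _

theorem pow_dvd_harmonicCoeff (hp : p.Prime) (hu : ∀ l, ¬ p ∣ l → (l : A) * u l = 1)
    {n : ℕ} (hn : 1 ≤ n) (hnp : n < p) (r : ℕ) {m : ℕ} (hm : 1 ≤ m) :
    (p : A) ^ r ∣ harmonicCoeff p u n m (r + 1) := by
  induction r generalizing m with
  | zero => simp
  | succ r ih =>
    have h := (pow_dvd_pow (p : A) (show r + 1 ≤ r + 1 + 1 by omega)).trans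
      (pow_dvd_harmonicCoeff_succ_sub hp hu hn hnp hm (show 1 ≤ r + 1 by omega))
    rw [← dvd_sub_right (?_)]
    · exact (dvd_sub_comm).1 h
    · refine Finset.dvd_sum fun a ha => ?_
      rw [pow_succ']
      refine mul_dvd_mul ?_ (ih (mem_Ico.1 ha).1)
      have := (Int.castRingHom A).map_dvd (dvd_boxCount hp hnp ha hm)
      simpa using this

/-- The combination of the sums at level `r` that governs the sums at level `r + 1`. -/
noncomputable def levelSum (p : ℕ) (u : ℕ → A) (n r : ℕ) : A :=
  ∑ a ∈ Ico 1 n, (punctured n a : A) * harmonicCoeff p u n a r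

theorem pow_dvd_factorial_mul_harmonicCoeff_sub (hp : p.Prime)
    (hu : ∀ l, ¬ p ∣ l → (l : A) * u l = 1) {n m r : ℕ} (hn : 1 ≤ n) (hnp : n < p) (hm : 1 ≤ m)
    (hr : 1 ≤ r) :
    (p : A) ^ (r + 1) ∣ ((n - 1).factorial : A) * harmonicCoeff p u n m (r + 1) -
      p * levelCoeff n m * levelSum p u n r := by
  obtain ⟨r, rfl⟩ := Nat.exists_eq_add_of_le' hr
  have h1 := (pow_dvd_harmonicCoeff_succ_sub hp hu hn hnp hm hr).mul_left ((n - 1).factorial : A)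
  have h2 : (p : A) ^ (r + 1 + 1) ∣ ∑ a ∈ Ico 1 n,
      (((n - 1).factorial : A) * (boxCount n p (m * p - a) : A) -
        p * punctured n a * levelCoeff n m) * harmonicCoeff p u n a (r + 1) := by
    refine Finset.dvd_sum fun a ha => ?_
    have ha' := mem_Ico.1 ha
    -- The box count is replaced with error `p^2`, and the sum it multiplies already contains `p^r`.
    rw [show r + 1 + 1 = 2 + r by omega, pow_add]
    refine mul_dvd_mul ?_ (pow_dvd_harmonicCoeff hp hu hn hnp r ha'.1)
    have := (Int.castRingHom A).map_dvd
      (factorial_mul_boxCount_modEq ha (by omega : a < p) hm).symm.dvd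
    simpa using this
  have h3 := dvd_add h1 h2
  convert h3 using 1
  rw [levelSum, mul_sub, Finset.mul_sum, Finset.mul_sum, sub_add, ← Finset.sum_sub_distrib]
  congr 1
  refine Finset.sum_congr rfl fun a _ => ?_
  ring

theorem pow_dvd_harmonicCoeff_succ_sub_mul (hp : p.Prime)
    (hu : ∀ l, ¬ p ∣ l → (l : A) * u l = 1) {n r : ℕ} (hn : 2 ≤ n) (hnp : n < p) (hr : 2 ≤ r) :
    (p : A) ^ (r + 1) ∣ harmonicCoeff p u n 1 (r + 1) - p * harmonicCoeff p u n 1 r := by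
  obtain ⟨r, rfl⟩ := Nat.exists_eq_add_of_le' (show 1 ≤ r by omega)
  obtain ⟨q, rfl⟩ := Nat.exists_eq_add_of_le' hn
  have hr1 : 1 ≤ r := by omega
  have hf : IsUnit (((q + 1).factorial : ℕ) : A) := isUnit_factorial_of_lt hu (by omega)
  -- Comparing `m` with `1` eliminates the common `levelSum` at the level below; this is where `2 ≤
  -- r` is needed.
  have hlev : ∀ m, 1 ≤ m → (p : A) ^ (r + 1) ∣ harmonicCoeff p u (q + 2) m (r + 1) -
      levelCoeff (q + 2) m * harmonicCoeff p u (q + 2) 1 (r + 1) := by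
    intro m hm
    have e1 := pow_dvd_factorial_mul_harmonicCoeff_sub hp hu (by omega) hnp hm hr1
    have e2 := (pow_dvd_factorial_mul_harmonicCoeff_sub hp hu (by omega) hnp le_rfl hr1).mul_left
      (levelCoeff (q + 2) m : A)
    rw [← hf.dvd_mul_left]
    convert dvd_sub e1 e2 using 1
    rw [levelCoeff_one, show q + 2 - 1 = q + 1 by omega]
    push_cast
    ring
  have e3 := pow_dvd_factorial_mul_harmonicCoeff_sub hp hu (by omega) hnp le_rfl
    (show 1 ≤ r + 1 by omega)
  have e4 : (p : A) ^ (r + 1 + 1) ∣ p * ∑ a ∈ Ico 1 (q + 2), (punctured (q + 2) a : A) *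
      (harmonicCoeff p u (q + 2) a (r + 1) -
        levelCoeff (q + 2) a * harmonicCoeff p u (q + 2) 1 (r + 1)) := by
    rw [pow_succ' (p : A) (r + 1)]
    exact mul_dvd_mul_left _ (Finset.dvd_sum fun a ha => (hlev a (mem_Ico.1 ha).1).mul_left _)
  rw [← hf.dvd_mul_left]
  convert dvd_add e3 e4 using 1
  have e5 := congrArg (Int.cast : ℤ → A) (sum_levelCoeff_mul_punctured q)
  push_cast at e5
  simp only [mul_sub, Finset.sum_sub_distrib, ← mul_assoc]
  rw [← Finset.sum_mul, e5, levelCoeff_one, show q + 2 - 1 = q + 1 by omega, levelSum]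
  push_cast
  ring

end

/-! ### Symmetries of powers of the truncated logarithm modulo `p` -/

section
variable {p : ℕ} [hp : Fact p.Prime]

theorem sum_range_eq_sum_zmod {M : Type*} [AddCommMonoid M] (f : ZMod p → M) :
    ∑ l ∈ range p, f l = ∑ x, f x := by
  refine Finset.sum_bij' (fun l _ => (l : ZMod p)) (fun x _ => x.val) ?_ ?_ ?_ ?_ ?_
  · simp
  · intro x _
    exact mem_range.2 (ZMod.val_lt x)
  · intro l hl
    exact ZMod.val_cast_of_lt (mem_range.1 hl)
  · intro x _
    exact ZMod.natCast_zmod_val x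
  · simp

theorem sum_zmod_pow {i : ℕ} (h0 : 0 < i) (h1 : i < 2 * (p - 1)) :
    ∑ x : ZMod p, x ^ i = if i = p - 1 then -1 else 0 := by
  have hp2 := hp.out.two_le
  rcases lt_trichotomy i (p - 1) with h | h | h
  · rw [if_neg h.ne]
    exact FiniteField.sum_pow_lt_card_sub_one _ i (by rwa [ZMod.card])
  · rw [if_pos h]
    have : ∀ x : ZMod p, x ^ i = 1 - if x = 0 then 1 else 0 := by
      intro x
      split_ifs with hx
      · rw [hx, zero_pow h0.ne', sub_self]
      · rw [h, ZMod.pow_card_sub_one_eq_one hx, sub_zero]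
    simp_rw [this]
    rw [Finset.sum_sub_distrib]
    simp
  · rw [if_neg h.ne']
    obtain ⟨k, rfl⟩ := Nat.exists_eq_add_of_lt h
    have : ∀ x : ZMod p, x ^ (p - 1 + k + 1) = x ^ (k + 1) := by
      intro x
      rw [show p - 1 + k + 1 = p + k by omega, pow_add, ZMod.pow_card, pow_succ']
    simp_rw [this]
    exact FiniteField.sum_pow_lt_card_sub_one _ _ (by rw [ZMod.card]; omega)

theorem sum_range_pow_zmod {i : ℕ} (h0 : 0 < i) (h1 : i < 2 * (p - 1)) :
    ∑ s ∈ range p, (s : ZMod p) ^ i = if i = p - 1 then -1 else 0 := by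
  rw [← sum_zmod_pow h0 h1, ← sum_range_eq_sum_zmod]

theorem natCast_ne_zero_of_lt {l : ℕ} (h0 : l ≠ 0) (h1 : l < p) : (l : ZMod p) ≠ 0 := by
  rw [Ne, ZMod.natCast_eq_zero_iff]
  exact Nat.not_dvd_of_pos_of_lt (Nat.pos_of_ne_zero h0) h1

variable (p) in
/-- The truncated logarithm `∑ X ^ l / l`, `0 < l < p`, over `ZMod p`. -/
noncomputable def truncLog : (ZMod p)[X] := ∑ l ∈ range p, monomial l (l : ZMod p)⁻¹

theorem coeff_truncLog (k : ℕ) :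
    (truncLog p).coeff k = if k < p then (k : ZMod p)⁻¹ else 0 := by
  simp [truncLog, coeff_monomial]

theorem harmonicPoly_one : harmonicPoly p (fun l => (l : ZMod p)⁻¹) 1 = truncLog p := by
  ext k
  rw [coeff_harmonicPoly, coeff_truncLog, pow_one]
  by_cases h : p ∣ k
  · rw [if_neg (by tauto), (ZMod.natCast_eq_zero_iff k p).2 h, inv_zero, ite_self]
  · simp [h]

theorem one_sub_X_pow_sub_one : (1 - X : (ZMod p)[X]) ^ (p - 1) = ∑ i ∈ range p, X ^ i := by
  have h : (1 - X : (ZMod p)[X]) ≠ 0 := by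
    intro h
    have := congrArg (eval 0) h
    simp at this
  refine mul_left_cancel₀ h ?_
  rw [← pow_succ', Nat.sub_add_cancel hp.out.one_le, sub_pow_char, one_pow, mul_neg_geom_sum]

theorem coeff_derivative_truncLog (k : ℕ) :
    (derivative (truncLog p)).coeff k = if k + 1 < p then 1 else 0 := by
  rw [coeff_derivative, coeff_truncLog]
  split_ifs with h
  · have := natCast_ne_zero_of_lt (p := p) (Nat.succ_ne_zero k) h
    push_cast at this ⊢
    exact inv_mul_cancel₀ this
  · simp

theorem derivative_truncLog :
    derivative (truncLog p) = (1 - X) ^ (p - 1) - X ^ (p - 1) := by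
  have hp1 := hp.out.one_le
  ext k
  rw [coeff_derivative_truncLog, one_sub_X_pow_sub_one, coeff_sub, finsetSum_coeff]
  simp only [coeff_X_pow, Finset.sum_ite_eq, mem_range]
  split_ifs <;> first | omega | simp

/-- Both sides have the same derivative and degree below `p`, so they differ by a constant, which is
`∑ 1/l = 0` over nonzero residues. -/
theorem truncLog_comp_one_sub_X (h2 : p ≠ 2) : (truncLog p).comp (1 - X) = truncLog p := by
  have hp2 := hp.out.two_le
  have hd : derivative ((truncLog p).comp (1 - X) - truncLog p) = 0 := by
    rw [derivative_sub, derivative_comp, derivative_truncLog]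
    simp
  have hdeg : (truncLog p).natDegree ≤ p - 1 := by
    refine natDegree_le_iff_coeff_eq_zero.2 fun k hk => ?_
    rw [coeff_truncLog, if_neg (by omega)]
  have hdeg' : ((truncLog p).comp (1 - X) - truncLog p).natDegree ≤ p - 1 := by
    refine (natDegree_sub_le _ _).trans (max_le ?_ hdeg)
    refine natDegree_comp_le.trans ?_
    have : (1 - X : (ZMod p)[X]).natDegree ≤ 1 := (natDegree_sub_le _ _).trans (by simp)
    calc _ ≤ (truncLog p).natDegree * 1 := Nat.mul_le_mul_left _ this
      _ ≤ p - 1 := by omega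
  rw [← sub_eq_zero]
  ext k
  rw [coeff_zero]
  rcases k with _ | k
  · rw [coeff_zero_eq_eval_zero, eval_sub, eval_comp]
    have h0 : eval 0 (truncLog p) = 0 := by
      rw [← coeff_zero_eq_eval_zero, coeff_truncLog]
      simp
    have h1 : eval 1 (truncLog p) = ∑ x : ZMod p, x ^ 1 := by
      rw [truncLog, eval_finsetSum]
      simp only [eval_monomial, one_pow, mul_one]
      rw [sum_range_eq_sum_zmod (fun x => x⁻¹)]
      simpa using inv_bijective.sum_comp (fun x : ZMod p => x)
    simp only [eval_sub, eval_one, eval_X, sub_zero, h0, h1]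
    rw [sum_zmod_pow one_pos (by omega), if_neg (by omega)]
  · by_cases hk : k + 1 ≤ p - 1
    · have := congrArg (fun f => coeff f k) hd
      simp only [coeff_derivative, coeff_zero] at this
      refine (mul_eq_zero.1 this).resolve_right ?_
      have := natCast_ne_zero_of_lt (p := p) (Nat.succ_ne_zero k) (by omega)
      push_cast at this
      exact this
    · exact natDegree_le_iff_coeff_eq_zero.1 hdeg' _ (by omega)

/-- The product of `m + 1, ..., m + p - 1` contains a multiple of `p` unless `p ∣ m`, when it is
Wilson's. -/
theorem descFactorial_add_sub_one (m : ℕ) :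
    (((m + (p - 1)).descFactorial (p - 1) : ℕ) : ZMod p) = if p ∣ m then -1 else 0 := by
  have hp1 := hp.out.pos
  rw [Nat.add_descFactorial_eq_ascFactorial, Nat.ascFactorial_eq_prod_range]
  push_cast
  split_ifs with h
  · rw [(ZMod.natCast_eq_zero_iff m p).2 h, ← ZMod.wilsons_lemma p,
      ← Finset.prod_range_add_one_eq_factorial]
    push_cast
    refine Finset.prod_congr rfl fun i _ => ?_
    ring
  · have h1 := Nat.mod_lt m hp1
    have h2 : 0 < m % p := Nat.pos_of_ne_zero fun h' => h (Nat.dvd_of_mod_eq_zero h')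
    refine Finset.prod_eq_zero (i := p - 1 - m % p) (mem_range.2 (by omega)) ?_
    have h3 : p ∣ m + 1 + (p - 1 - m % p) := by
      refine ⟨m / p + 1, ?_⟩
      have := Nat.div_add_mod m p
      rw [mul_add, mul_one]
      omega
    have := (ZMod.natCast_eq_zero_iff _ p).2 h3
    push_cast at this
    exact this

/-- Extraction of the coefficients of exponent divisible by `p` as an iterated derivative. -/
theorem expand_eq_neg_iterate_derivative {P G : (ZMod p)[X]}
    (h : ∀ m, P.coeff m = G.coeff (m * p)) :
    expand (ZMod p) p P = -derivative^[p - 1] (X ^ (p - 1) * G) := by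
  ext m
  rw [coeff_neg, coeff_iterate_derivative, coeff_X_pow_mul, nsmul_eq_mul,
    descFactorial_add_sub_one, coeff_expand hp.out.pos]
  split_ifs with hm
  · rw [h, Nat.div_mul_cancel hm]
    ring
  · simp

theorem iterate_derivative_derivative_eq_zero (G : (ZMod p)[X]) :
    derivative^[p - 1] (derivative G) = 0 := by
  rw [← Function.iterate_succ_apply, Nat.succ_eq_add_one, Nat.sub_add_cancel hp.out.one_le]
  ext m
  rw [coeff_iterate_derivative, coeff_zero, nsmul_eq_mul, (ZMod.natCast_eq_zero_iff _ p).2,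
    zero_mul]
  exact (Nat.dvd_factorial hp.out.pos le_rfl).trans (Nat.factorial_dvd_descFactorial _ _)

/-- The polynomial of the coefficients of exponent divisible by `p` of a power of the truncated
logarithm is invariant under `X ↦ 1 - X`. -/
theorem comp_one_sub_X_eq_self {n : ℕ} (hn : n + 1 < p) (h2 : p ≠ 2) {P : (ZMod p)[X]}
    (h : ∀ m, P.coeff m = (truncLog p ^ n).coeff (m * p)) : P.comp (1 - X) = P := by
  have h1 := expand_eq_neg_iterate_derivative h
  have hev : Even (p - 1) := hp.out.even_sub_one h2
  refine expand_injective hp.out.pos ?_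
  have e1 : expand (ZMod p) p (P.comp (1 - X)) = (expand (ZMod p) p P).comp (1 - X) := by
    rw [expand_eq_comp_X_pow, expand_eq_comp_X_pow, comp_assoc, comp_assoc]
    congr 1
    simp [sub_pow_char]
  -- Replacing `X^(p-1)` by `(1 - X)^(p-1)` adds `L' L^n`, the derivative of `L^(n+1) / (n+1)`, and
  -- the `p`-th derivative is zero.
  have e2 : derivative^[p - 1] (((1 - X) ^ (p - 1) - X ^ (p - 1)) * truncLog p ^ n) = 0 := by
    have hne : ((n + 1 : ℕ) : ZMod p) ≠ 0 := natCast_ne_zero_of_lt (Nat.succ_ne_zero n) hn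
    have : ((1 - X) ^ (p - 1) - X ^ (p - 1)) * truncLog p ^ n =
        derivative (C ((n + 1 : ℕ) : ZMod p)⁻¹ * truncLog p ^ (n + 1)) := by
      rw [derivative_C_mul, derivative_pow, derivative_truncLog, Nat.add_sub_cancel, ← mul_assoc,
        ← mul_assoc, ← C_mul, inv_mul_cancel₀ hne, C_1, one_mul, mul_comm]
    rw [this, iterate_derivative_derivative_eq_zero]
  rw [e1, h1, neg_comp]
  congr 1
  have e3 := iterate_derivative_comp_one_sub_X (X ^ (p - 1) * truncLog p ^ n) (p - 1)
  rw [hev.neg_one_pow, one_mul, mul_comp, pow_comp, pow_comp, X_comp,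
    truncLog_comp_one_sub_X h2] at e3
  rw [← e3, ← sub_eq_zero, ← iterate_derivative_sub, ← sub_mul, e2]

/-- `1 / (p - l) = -1 / l` modulo `p`. -/
theorem reflect_truncLog : reflect p (truncLog p) = -truncLog p := by
  ext i
  rw [coeff_reflect, coeff_neg, coeff_truncLog, coeff_truncLog]
  by_cases h : i ≤ p
  · rw [revAt_le h]
    rcases Nat.eq_zero_or_pos i with rfl | h0
    · simp
    · rcases h.eq_or_lt with rfl | h1
      · simp
      · rw [if_pos (by omega), if_pos h1, Nat.cast_sub h, CharP.cast_eq_zero, zero_sub, inv_neg]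
  · rw [revAt_eq_self_of_lt (by omega), if_neg (by omega), neg_zero]

theorem reflect_truncLog_pow (n : ℕ) :
    reflect (n * p) (truncLog p ^ n) = (-truncLog p) ^ n := by
  have hdeg : (truncLog p).natDegree ≤ p := by
    refine natDegree_le_iff_coeff_eq_zero.2 fun k hk => ?_
    rw [coeff_truncLog, if_neg (by omega)]
  induction n with
  | zero => simp
  | succ n ih =>
    rw [pow_succ, add_mul, one_mul,
      reflect_mul _ _ (natDegree_pow_le.trans (Nat.mul_le_mul_left _ hdeg)) hdeg, ih,
      reflect_truncLog, pow_succ]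

theorem coeff_truncLog_pow_sub {n a : ℕ} (hn : Odd n) (ha : a ≤ n) :
    (truncLog p ^ n).coeff ((n - a) * p) = -(truncLog p ^ n).coeff (a * p) := by
  have h := congrArg (fun f => coeff f (a * p)) (reflect_truncLog_pow (p := p) n)
  simp only [coeff_reflect, hn.neg_pow, coeff_neg] at h
  rw [revAt_le (Nat.mul_le_mul_right _ ha)] at h
  rw [Nat.sub_mul, h]

theorem coeff_truncLog_pow_eq_zero {n a : ℕ} (hn : 1 ≤ n) (ha : a = 0 ∨ n ≤ a) :
    (truncLog p ^ n).coeff (a * p) = 0 := by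
  have := harmonicCoeff_eq_zero (u := fun l => (l : ZMod p)⁻¹) hp.out (r := 1) hn ha
  rwa [harmonicCoeff, harmonicPoly_one, pow_one] at this

theorem coeff_truncLog_pow_seven (h7 : 8 < p) :
    (truncLog p ^ 7).coeff (2 * p) = -3 * (truncLog p ^ 7).coeff (1 * p) ∧
      (truncLog p ^ 7).coeff (3 * p) = 5 * (truncLog p ^ 7).coeff (1 * p) := by
  set s : ℕ → ZMod p := fun a => (truncLog p ^ 7).coeff (a * p) with hs
  have h4 : s 4 = -s 3 := coeff_truncLog_pow_sub (n := 7) (a := 3) (by decide) (by omega)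
  have h5 : s 5 = -s 2 := coeff_truncLog_pow_sub (n := 7) (a := 2) (by decide) (by omega)
  have h6 : s 6 = -s 1 := coeff_truncLog_pow_sub (n := 7) (a := 1) (by decide) (by omega)
  have h0 : s 0 = 0 := coeff_truncLog_pow_eq_zero (by omega) (Or.inl rfl)
  have hP := comp_one_sub_X_eq_self (p := p) (n := 7) (by omega) (by omega)
    (P := ∑ a ∈ range 7, monomial a (s a)) (by
      intro m
      simp only [finsetSum_coeff, coeff_monomial, Finset.sum_ite_eq', mem_range]
      split_ifs with h
      · rfl
      · exact (coeff_truncLog_pow_eq_zero (by omega) (Or.inr (by omega))).symm)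
  have e1 := congrArg (eval 2) hP
  have e2 := congrArg (eval 3) hP
  rw [eval_comp] at e1 e2
  simp only [eval_add, eval_zero, eval_monomial, eval_sub, eval_one, eval_X, Finset.sum_range_succ,
    Finset.sum_range_zero, h0, h4, h5, h6] at e1 e2
  have n2 : (2 : ZMod p) ≠ 0 := by
    exact_mod_cast natCast_ne_zero_of_lt (p := p) (l := 2) (by omega) (by omega)
  have n3 : (3 : ZMod p) ≠ 0 := by
    exact_mod_cast natCast_ne_zero_of_lt (p := p) (l := 3) (by omega) (by omega)
  have n5 : (5 : ZMod p) ≠ 0 := by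
    exact_mod_cast natCast_ne_zero_of_lt (p := p) (l := 5) (by omega) (by omega)
  -- Comparing values at `-1` and `2`, then at `-2` and `3`, gives two equations, after removing the
  -- factors 6 and 30.
  have f1 : 10 * s 1 + 5 * s 2 + s 3 = 0 := by
    refine mul_left_cancel₀ (mul_ne_zero n2 n3) ?_
    linear_combination e1
  have f2 : 22 * s 1 + 9 * s 2 + s 3 = 0 := by
    refine mul_left_cancel₀ (mul_ne_zero n2 (mul_ne_zero n3 n5)) ?_
    linear_combination e2
  have g2 : s 2 = -3 * s 1 := by
    refine mul_left_cancel₀ (mul_ne_zero n2 n2) ?_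
    linear_combination f2 - f1
  refine ⟨g2, ?_⟩
  change s 3 = 5 * s 1
  linear_combination f1 - 5 * g2

end

/-! ### The first coefficient as a Bernoulli number -/

section
variable {p : ℕ} [hp : Fact p.Prime]

variable (p) in
/-- `∏ (1 + X / v)` over `0 < v < k` (the factor for `v = 0` is `1`). -/
noncomputable def risingPoly (k : ℕ) : (ZMod p)[X] := ∏ v ∈ range k, (1 + C (v : ZMod p)⁻¹ * X)

theorem risingPoly_succ (k : ℕ) :
    risingPoly p (k + 1) = risingPoly p k * (1 + C (k : ZMod p)⁻¹ * X) :=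
  Finset.prod_range_succ _ _

theorem coeff_zero_risingPoly (k : ℕ) : (risingPoly p k).coeff 0 = 1 := by
  rw [risingPoly, coeff_zero_eq_eval_zero, eval_prod]
  simp

theorem coeff_succ_risingPoly (n k : ℕ) :
    (risingPoly p k).coeff (n + 1) = ∑ v ∈ range k, (risingPoly p v).coeff n * (v : ZMod p)⁻¹ := by
  induction k with
  | zero => simp [risingPoly, coeff_one]
  | succ k ih =>
    rw [Finset.sum_range_succ, ← ih, risingPoly_succ, mul_add, mul_one, ← mul_assoc, coeff_add,
      coeff_mul_X, coeff_mul_C]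

theorem natDegree_risingPoly_le (k : ℕ) : (risingPoly p k).natDegree ≤ k - 1 := by
  induction k with
  | zero => simp [risingPoly]
  | succ k ih =>
    rw [risingPoly_succ]
    rcases k with _ | k
    · simp [risingPoly]
    · refine natDegree_mul_le.trans ?_
      have : (1 + C ((k + 1 : ℕ) : ZMod p)⁻¹ * X).natDegree ≤ 1 :=
        (natDegree_add_le _ _).trans (max_le (by simp) ((natDegree_C_mul_le _ _).trans natDegree_X_le))
      omega

/-- As `L' = 1 + X + ... + X^(p-2)`, differentiating a power of `L` expresses `k` times its `k`-th
coefficient by a partial sum of coefficients of the previous power. -/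
theorem coeff_truncLog_pow_succ (n : ℕ) {k : ℕ} (hk : k < p) :
    (truncLog p ^ (n + 1)).coeff k =
      (n + 1).factorial * ((risingPoly p k).coeff n * (k : ZMod p)⁻¹) := by
  induction n generalizing k with
  | zero => simp [coeff_truncLog, hk, coeff_zero_risingPoly]
  | succ n ih =>
    rcases k with _ | k
    · have := coeff_truncLog_pow_eq_zero (p := p) (n := n + 1 + 1) (a := 0) (by omega) (Or.inl rfl)
      rw [zero_mul] at this
      simp [this]
    · have hne := natCast_ne_zero_of_lt (p := p) (Nat.succ_ne_zero k) hk
      have h1 : (truncLog p ^ (n + 1 + 1)).coeff (k + 1) * ((k + 1 : ℕ) : ZMod p) =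
          ((n + 1 + 1 : ℕ) : ZMod p) * ∑ v ∈ range (k + 1), (truncLog p ^ (n + 1)).coeff v := by
        have := coeff_derivative (truncLog p ^ (n + 1 + 1)) k
        rw [Nat.cast_succ k, ← this, derivative_pow, Nat.add_sub_cancel, mul_assoc, coeff_C_mul,
          coeff_mul, Finset.Nat.sum_antidiagonal_eq_sum_range_succ_mk]
        congr 1
        refine Finset.sum_congr rfl fun v hv => ?_
        rw [coeff_derivative_truncLog, if_pos (by omega), mul_one]
      refine mul_right_cancel₀ hne ?_
      rw [h1, mul_assoc, mul_assoc, inv_mul_cancel₀ hne, mul_one, Nat.factorial_succ (n + 1),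
        Nat.cast_mul, mul_assoc, coeff_succ_risingPoly]
      congr 1
      rw [Finset.mul_sum]
      refine Finset.sum_congr rfl fun v hv => ?_
      rw [mem_range] at hv
      exact ih (by omega)

variable (p) in
/-- `∑ k ^ (-2) ∏ (1 + X / v)` over `0 < v < k < p`. -/
noncomputable def risingSum : (ZMod p)[X] :=
  ∑ k ∈ range p, C ((k : ZMod p)⁻¹ ^ 2) * risingPoly p k

theorem coeff_prime_truncLog_pow (n : ℕ) :
    (truncLog p ^ (n + 2)).coeff p = -((n + 1).factorial * (risingSum p).coeff n) := by
  rw [pow_succ, coeff_mul, Finset.Nat.sum_antidiagonal_eq_sum_range_succ_mk,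
    Finset.sum_range_succ]
  have h0 : (truncLog p).coeff (p - p) = 0 := by simp [coeff_truncLog]
  rw [h0, mul_zero, add_zero, risingSum, finsetSum_coeff, Finset.mul_sum, ← Finset.sum_neg_distrib]
  refine Finset.sum_congr rfl fun k hk => ?_
  rw [mem_range] at hk
  rw [coeff_truncLog_pow_succ n hk, coeff_C_mul, coeff_truncLog]
  rcases Nat.eq_zero_or_pos k with rfl | h
  · simp
  · rw [if_pos (by omega), Nat.cast_sub hk.le, CharP.cast_eq_zero (ZMod p) p, zero_sub, inv_neg]
    ring

theorem eval_neg_risingPoly (s : ℕ) {k : ℕ} (hk : k < p) :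
    (risingPoly p (k + 1)).eval (-((s + 1 : ℕ) : ZMod p)) = (-1) ^ k * (s.choose k : ZMod p) := by
  induction k with
  | zero => simp [risingPoly]
  | succ k ih =>
    rw [risingPoly_succ, eval_mul, ih (by omega)]
    have hne := natCast_ne_zero_of_lt (p := p) (Nat.succ_ne_zero k) hk
    have h : (s.choose (k + 1) : ZMod p) * ((k + 1 : ℕ) : ZMod p) =
        s.choose k * ((s : ZMod p) - k) := by
      rcases le_or_gt k s with h | h
      · rw [← Nat.cast_sub h]
        exact_mod_cast congrArg (Nat.cast : ℕ → ZMod p) (Nat.choose_succ_right_eq s k)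
      · rw [Nat.choose_eq_zero_of_lt h, Nat.choose_eq_zero_of_lt (by omega)]
        simp
    refine mul_right_cancel₀ hne ?_
    rw [mul_assoc _ (s.choose (k + 1) : ZMod p), h]
    simp only [eval_add, eval_one, eval_mul, eval_C, eval_X]
    rw [Nat.succ_eq_add_one] at hne
    field_simp
    push_cast
    ring

theorem sum_alternating_choose {s : ℕ} (h0 : 0 < s) (hs : s < p) :
    ∑ k ∈ range p, (-1) ^ k * (s.choose k : ZMod p) = 0 := by
  have h1 : ∑ k ∈ range (s + 1), (-1) ^ k * (s.choose k : ZMod p) = 0 := by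
    have := congrArg (Int.cast : ℤ → ZMod p) (Int.alternating_sum_range_choose (n := s))
    rw [if_neg h0.ne'] at this
    exact_mod_cast this
  rw [← h1]
  symm
  refine Finset.sum_subset (fun k => ?_) fun k _ hk => ?_
  · simp only [mem_range]
    omega
  · rw [mem_range] at hk
    rw [Nat.choose_eq_zero_of_lt (by omega), Nat.cast_zero, mul_zero]

theorem sum_alternating_choose_mul_inv {s : ℕ} (hs : s < p) :
    ∑ k ∈ range p, (-1) ^ (k + 1) * (s.choose k : ZMod p) * (k : ZMod p)⁻¹ =
      ∑ i ∈ Ico 1 (s + 1), (i : ZMod p)⁻¹ := by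
  induction s with
  | zero =>
    rw [Finset.sum_eq_zero]
    · simp
    · intro k _
      rcases k with _ | k <;> simp
  | succ s ih =>
    have hne := natCast_ne_zero_of_lt (p := p) (Nat.succ_ne_zero s) hs
    rw [Finset.sum_Ico_succ_top (by omega), ← ih (by omega), ← sub_eq_iff_eq_add',
      ← Finset.sum_sub_distrib]
    have hp1 : range p = range (p - 1 + 1) := by rw [Nat.sub_add_cancel hp.out.one_le]
    have h := sum_alternating_choose (p := p) (Nat.succ_pos s) hs
    rw [hp1, Finset.sum_range_succ'] at h ⊢
    simp only [Nat.choose_zero_right, sub_self, add_zero, pow_zero, Nat.cast_one, mul_one] at h ⊢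
    refine mul_right_cancel₀ hne ?_
    rw [inv_mul_cancel₀ hne, Finset.sum_mul, ← sub_eq_zero, ← neg_eq_zero, ← h, neg_sub,
      sub_eq_add_neg, add_comm, ← Finset.sum_neg_distrib]
    congr 1
    refine Finset.sum_congr rfl fun k hk => ?_
    rw [mem_range] at hk
    have hne' := natCast_ne_zero_of_lt (p := p) (Nat.succ_ne_zero k) (by omega)
    have e1 := congrArg (Nat.cast : ℕ → ZMod p) (Nat.add_one_mul_choose_eq s k)
    have e2 := congrArg (Nat.cast : ℕ → ZMod p) (Nat.choose_succ_succ s k)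
    push_cast at e1 e2 hne' hne ⊢
    rw [e2] at e1 ⊢
    field_simp
    linear_combination -(-1) ^ k * e1

/-- At `-s` the products become signed binomials, and `∑ (-1)^(k+1) C(s,k) / k` is the harmonic
number. -/
theorem eval_neg_risingSum {s : ℕ} (h0 : 0 < s) (hs : s < p) :
    (risingSum p).eval (-(s : ZMod p)) =
      (s : ZMod p)⁻¹ * ∑ i ∈ Ico 1 (s + 1), (i : ZMod p)⁻¹ := by
  obtain ⟨t, rfl⟩ := Nat.exists_eq_add_of_le' h0
  have hne := natCast_ne_zero_of_lt (p := p) (Nat.succ_ne_zero t) hs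
  rw [← sum_alternating_choose_mul_inv hs, risingSum, eval_finsetSum, Finset.mul_sum]
  refine Finset.sum_congr rfl fun k hk => ?_
  rw [mem_range] at hk
  rcases k with _ | k
  · simp
  · have hne' := natCast_ne_zero_of_lt (p := p) (Nat.succ_ne_zero k) hk
    rw [eval_mul, eval_C, eval_neg_risingPoly t (by omega)]
    have e1 := congrArg (Nat.cast : ℕ → ZMod p) (Nat.add_one_mul_choose_eq t k)
    push_cast at e1 hne' hne ⊢
    field_simp
    linear_combination (-1) ^ k * e1

theorem natDegree_risingSum_lt : (risingSum p).natDegree < p - 1 := by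
  have hp2 := hp.out.two_le
  refine lt_of_le_of_lt (natDegree_sum_le_of_forall_le (n := p - 2) _ _ fun k hk => ?_) (by omega)
  rw [mem_range] at hk
  refine (natDegree_C_mul_le _ _).trans ((natDegree_risingPoly_le k).trans (by omega))

/-- Orthogonality of power sums over `ZMod p` recovers the coefficients from the values. -/
theorem coeff_eq_neg_sum_pow_mul_eval {f : (ZMod p)[X]} (hf : f.natDegree < p - 1) {k : ℕ}
    (hk : k < p - 1) : f.coeff k = -∑ x : ZMod p, x ^ (p - 1 - k) * f.eval x := by
  simp_rw [eval_eq_sum_range' hf, Finset.mul_sum]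
  rw [Finset.sum_comm]
  have : ∀ j ∈ range (p - 1), ∑ x : ZMod p, x ^ (p - 1 - k) * (f.coeff j * x ^ j) =
      if j = k then -f.coeff j else 0 := by
    intro j hj
    rw [mem_range] at hj
    have h := sum_zmod_pow (p := p) (i := p - 1 - k + j) (by omega) (by omega)
    calc _ = f.coeff j * ∑ x : ZMod p, x ^ (p - 1 - k + j) := by
          rw [Finset.mul_sum]
          refine Finset.sum_congr rfl fun x _ => ?_
          rw [pow_add]
          ring
      _ = _ := by
          rw [h]
          split_ifs <;> first | omega | simp
  rw [Finset.sum_congr rfl this]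
  simp [hk]

theorem coeff_risingSum {k : ℕ} (hk : k + 1 < p - 1) (hodd : Odd k) (h2 : p ≠ 2) :
    (risingSum p).coeff k = ∑ s ∈ range p, (s : ZMod p) ^ (p - 2 - k) *
      ∑ i ∈ Ico 1 (s + 1), (i : ZMod p)⁻¹ := by
  have hev : Even (p - 1) := hp.out.even_sub_one h2
  have ho : Odd (p - 1 - k) := Nat.Even.sub_odd (by omega) hev hodd
  rw [coeff_eq_neg_sum_pow_mul_eval natDegree_risingSum_lt (by omega),
    ← Equiv.sum_comp (Equiv.neg (ZMod p)), ← Finset.sum_neg_distrib,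
    ← sum_range_eq_sum_zmod]
  refine Finset.sum_congr rfl fun s hs => ?_
  rw [mem_range] at hs
  rw [Equiv.neg_apply, ho.neg_pow, neg_mul, neg_neg]
  rcases Nat.eq_zero_or_pos s with rfl | h0
  · rw [Nat.cast_zero, zero_pow (by omega)]
    simp
  · have hne := natCast_ne_zero_of_lt (p := p) h0.ne' hs
    rw [eval_neg_risingSum h0 hs, show p - 1 - k = p - 2 - k + 1 by omega, pow_succ, mul_assoc,
      mul_inv_cancel_left₀ hne]

theorem natCast_choose_sub_one {k : ℕ} (hk : k < p) :
    ((p - 1).choose k : ZMod p) = (-1) ^ k := by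
  induction k with
  | zero => simp
  | succ k ih =>
    have h := Nat.choose_succ_succ (p - 1) k
    rw [Nat.succ_eq_add_one, Nat.succ_eq_add_one, Nat.sub_add_cancel hp.out.one_le] at h
    have h1 := congrArg (Nat.cast : ℕ → ZMod p) h
    rw [(ZMod.natCast_eq_zero_iff _ p).2 (hp.out.dvd_choose_self (Nat.succ_ne_zero k) hk)] at h1
    push_cast at h1
    rw [ih (by omega)] at h1
    rw [pow_succ]
    linear_combination -h1

/-- If the `b j` satisfy Faulhaber's formula of exponent `p - 2`, the double harmonic sum is one of
them. -/
theorem sum_pow_mul_sum_inv {b : ℕ → ZMod p}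
    (hb : ∀ s : ℕ, ((p - 1 : ℕ) : ZMod p) * ∑ i ∈ Ico 1 (s + 1), (i : ZMod p) ^ (p - 2) =
      ∑ j ∈ range (p - 1), b j * ((p - 1).choose j : ZMod p) * (s : ZMod p) ^ (p - 1 - j))
    {k : ℕ} (h0 : 0 < k) (hk : k + 2 < p) :
    ∑ s ∈ range p, (s : ZMod p) ^ (p - 1 - k) * ∑ i ∈ Ico 1 (s + 1), (i : ZMod p)⁻¹ =
      (-1) ^ (p - 1 - k) * b (p - 1 - k) := by
  have hH : ∀ s ∈ range p, ∑ i ∈ Ico 1 (s + 1), (i : ZMod p)⁻¹ =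
      -∑ j ∈ range (p - 1), b j * ((p - 1).choose j : ZMod p) * (s : ZMod p) ^ (p - 1 - j) := by
    intro s hs
    rw [mem_range] at hs
    rw [← hb, Nat.cast_sub hp.out.one_le, CharP.cast_eq_zero, Nat.cast_one, zero_sub, neg_one_mul,
      neg_neg]
    refine Finset.sum_congr rfl fun i hi => ?_
    rw [mem_Ico] at hi
    have hne := natCast_ne_zero_of_lt (p := p) (l := i) (by omega) (by omega)
    refine inv_eq_of_mul_eq_one_right ?_
    rw [← pow_succ', show p - 2 + 1 = p - 1 by omega, ZMod.pow_card_sub_one_eq_one hne]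
  -- The power sum over `s` survives only when its exponent is `p - 1`, which selects a single `j`.
  have hterm : ∀ j ∈ range (p - 1), ∑ s ∈ range p, (s : ZMod p) ^ (p - 1 - k) *
      (b j * ((p - 1).choose j : ZMod p) * (s : ZMod p) ^ (p - 1 - j)) =
      if j = p - 1 - k then -((-1) ^ j * b j) else 0 := by
    intro j hj
    rw [mem_range] at hj
    have h := sum_range_pow_zmod (p := p) (i := p - 1 - k + (p - 1 - j)) (by omega) (by omega)
    calc _ = b j * (-1) ^ j * ∑ s ∈ range p, (s : ZMod p) ^ (p - 1 - k + (p - 1 - j)) := by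
          rw [Finset.mul_sum, natCast_choose_sub_one (by omega)]
          refine Finset.sum_congr rfl fun s _ => ?_
          rw [pow_add]
          ring
      _ = _ := by
          rw [h]
          split_ifs <;> first | omega | ring
  rw [Finset.sum_congr rfl fun s hs => by rw [hH s hs]]
  simp only [mul_neg, Finset.sum_neg_distrib, Finset.mul_sum]
  rw [Finset.sum_comm, Finset.sum_congr rfl hterm, Finset.sum_ite_eq', if_pos (by
    rw [mem_range]; omega), neg_neg]

end

/-! ### Transfer between `ℚ`, `ℤ_[p]` and `ZMod p` -/

theorem harmonicPoly_congr {A : Type*} [CommRing A] {p : ℕ} {u v : ℕ → A}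
    (h : ∀ l, ¬ p ∣ l → u l = v l) (r : ℕ) : harmonicPoly p u r = harmonicPoly p v r := by
  refine Finset.sum_congr rfl fun l hl => ?_
  rw [h l (mem_filter.1 hl).2]

theorem S_eq_harmonicCoeff (n m p r : ℕ) :
    S n m p r = harmonicCoeff p (fun l => (l : ℚ)⁻¹) n m r := by
  classical
  have h1 : harmonicPoly p (fun l => (l : ℚ)⁻¹) r ^ n =
      ∏ _i : Fin n, harmonicPoly p (fun l => (l : ℚ)⁻¹) r := by simp
  have h2 : ∀ x : Fin n → ℕ, ∏ i, monomial (x i) ((x i : ℚ)⁻¹) =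
      monomial (∑ i, x i) (∏ i, (x i : ℚ))⁻¹ := by
    intro x
    simp only [← C_mul_X_pow_eq_monomial]
    rw [Finset.prod_mul_distrib, Finset.prod_pow_eq_pow_sum, ← Finset.prod_inv_distrib, map_prod]
  rw [harmonicCoeff, h1]
  simp only [harmonicPoly]
  rw [Finset.prod_univ_sum, finsetSum_coeff]
  simp only [h2, coeff_monomial]
  rw [← Finset.sum_filter, S]
  refine Finset.sum_congr ?_ fun x _ => one_div _
  ext x
  have hfree : ∀ l, l ∈ pFree p ↔ 0 < l ∧ ¬ p ∣ l := fun _ => Iff.rfl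
  simp only [mem_filter, Fintype.mem_piFinset, mem_range]
  constructor
  · rintro ⟨h, h', h''⟩
    exact ⟨fun i => ⟨h i, ((hfree _).1 (h' i)).2⟩, h''⟩
  · rintro ⟨h, h''⟩
    refine ⟨fun i => (h i).1, fun i => (hfree _).2 ⟨Nat.pos_of_ne_zero fun h0 => (h i).2 ?_,
      (h i).2⟩, h''⟩
    rw [h0]
    exact dvd_zero p

section
variable {p : ℕ} [hp : Fact p.Prime]

theorem padicInt_mul_inv (l : ℕ) (hl : ¬ p ∣ l) :
    (l : ℤ_[p]) * PadicInt.inv (l : ℤ_[p]) = 1 := by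
  refine PadicInt.mul_inv ?_
  rw [PadicInt.norm_natCast_eq_one_iff]
  exact (hp.out.coprime_iff_not_dvd).2 hl

theorem coe_padicInt_inv (l : ℕ) (hl : ¬ p ∣ l) :
    ((PadicInt.inv (l : ℤ_[p]) : ℤ_[p]) : ℚ_[p]) = (l : ℚ_[p])⁻¹ := by
  have h := congrArg (fun z : ℤ_[p] => (z : ℚ_[p])) (padicInt_mul_inv l hl)
  simp only [PadicInt.coe_mul, PadicInt.coe_natCast, PadicInt.coe_one] at h
  exact eq_inv_of_mul_eq_one_right h

variable (p) in
/-- The sum `S n m p r` as a `p`-adic integer. -/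
noncomputable def padicS (n m r : ℕ) : ℤ_[p] :=
  harmonicCoeff p (fun l => PadicInt.inv (l : ℤ_[p])) n m r

theorem coe_padicS (n m r : ℕ) : ((padicS p n m r : ℤ_[p]) : ℚ_[p]) = (S n m p r : ℚ) := by
  have h1 := map_harmonicCoeff (PadicInt.Coe.ringHom (p := p)) p
    (fun l => PadicInt.inv (l : ℤ_[p])) n m r
  have h2 := map_harmonicCoeff (Rat.castHom ℚ_[p]) p (fun l => (l : ℚ)⁻¹) n m r
  rw [S_eq_harmonicCoeff]
  refine h1.trans (Eq.trans ?_ h2.symm)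
  rw [harmonicCoeff, harmonicCoeff]
  congr 2
  refine harmonicPoly_congr (fun l hl => ?_) r
  rw [map_inv₀, map_natCast]
  exact coe_padicInt_inv l hl

theorem congrModPow_of_dvd {k : ℕ} {a b : ℚ} {x y : ℤ_[p]} (hx : (x : ℚ_[p]) = a)
    (hy : (y : ℚ_[p]) = b) (h : (p : ℤ_[p]) ^ k ∣ x - y) : CongrModPow p k a b := by
  obtain ⟨z, hz⟩ := h
  have hp0 : (p : ℚ) ^ k ≠ 0 := pow_ne_zero _ (Nat.cast_ne_zero.2 hp.out.ne_zero)
  have hp0' : (p : ℚ_[p]) ^ k ≠ 0 := pow_ne_zero _ (Nat.cast_ne_zero.2 hp.out.ne_zero)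
  refine ⟨(a - b) / (p : ℚ) ^ k, ?_, by field_simp⟩
  have hc : (((a - b) / (p : ℚ) ^ k : ℚ) : ℚ_[p]) = z := by
    have := congrArg (fun z : ℤ_[p] => (z : ℚ_[p])) hz
    simp only [PadicInt.coe_sub, PadicInt.coe_mul, PadicInt.coe_pow, PadicInt.coe_natCast] at this
    push_cast
    rw [← hx, ← hy, this, mul_div_cancel_left₀ _ hp0']
  have hu := PadicInt.isUnit_den ((a - b) / (p : ℚ) ^ k) (by rw [hc]; exact z.2)
  rw [PadicInt.isUnit_iff, PadicInt.norm_natCast_eq_one_iff] at hu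
  exact (hp.out.coprime_iff_not_dvd).1 hu

/-- The denominators in the recursion are at most `j + 1 < p`. -/
theorem exists_padicInt_eq_bernoulli' {j : ℕ} (hj : j + 1 < p) :
    ∃ z : ℤ_[p], (z : ℚ_[p]) = (bernoulli' j : ℚ) := by
  induction j using Nat.strong_induction_on with
  | _ j ih =>
    choose! z hz using fun k (hk : k < j) => ih k hk (by omega)
    refine ⟨1 - ∑ k ∈ range j,
      (j.choose k : ℤ_[p]) * PadicInt.inv ((j - k + 1 : ℕ) : ℤ_[p]) * z k, ?_⟩
    rw [bernoulli'_def, PadicInt.coe_sub, PadicInt.coe_one, PadicInt.coe_sum]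
    push_cast
    congr 1
    refine Finset.sum_congr rfl fun k hk => ?_
    rw [mem_range] at hk
    have := coe_padicInt_inv (p := p) (j - k + 1)
      (Nat.not_dvd_of_pos_of_lt (by omega) (by omega))
    push_cast [Nat.cast_sub hk.le] at this ⊢
    rw [hz k hk, this, div_eq_mul_inv]

theorem exists_bernoulli_harmonic (h8 : 8 < p) : ∃ z : ℤ_[p],
    (z : ℚ_[p]) = (bernoulli (p - 7) : ℚ) ∧
      (truncLog p ^ 7).coeff (1 * p) = -720 * PadicInt.toZMod z := by
  choose! z hz using fun j (hj : j + 1 < p) => exists_padicInt_eq_bernoulli' (p := p) hj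
  have hF : ∀ s : ℕ, ((p - 1 : ℕ) : ℤ_[p]) * ∑ i ∈ Ico 1 (s + 1), (i : ℤ_[p]) ^ (p - 2) =
      ∑ j ∈ range (p - 1), z j * ((p - 1).choose j : ℤ_[p]) * (s : ℤ_[p]) ^ (p - 1 - j) := by
    intro s
    have h0 : ((p - 1 : ℕ) : ℚ) ≠ 0 := Nat.cast_ne_zero.2 (by omega)
    have h := sum_Ico_pow s (p - 2)
    have e : ((p - 2 : ℕ) : ℚ) + 1 = ((p - 1 : ℕ) : ℚ) := by
      rw [← Nat.cast_succ]
      congr 1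
      omega
    rw [show p - 2 + 1 = p - 1 by omega, e, ← Finset.sum_div, eq_div_iff h0, mul_comm] at h
    have h' := congrArg (Rat.cast : ℚ → ℚ_[p]) h
    apply PadicInt.ext
    simp only [PadicInt.coe_mul, PadicInt.coe_sum, PadicInt.coe_pow, PadicInt.coe_natCast]
    rw [Rat.cast_mul, Rat.cast_sum, Rat.cast_sum] at h'
    simp only [Rat.cast_mul, Rat.cast_pow, Rat.cast_natCast] at h'
    rw [h']
    refine Finset.sum_congr rfl fun j hj => ?_
    rw [mem_range] at hj
    rw [hz j (by omega)]
  have hp9 : p ≠ 8 := by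
    rintro rfl
    omega
  refine ⟨z (p - 7), ?_, ?_⟩
  · rw [hz (p - 7) (by omega), bernoulli_eq_bernoulli'_of_ne_one (by omega)]
  · have hb := sum_pow_mul_sum_inv (p := p) (b := fun j => PadicInt.toZMod (z j)) (k := 6)
      (fun s => by
        have := congrArg PadicInt.toZMod (hF s)
        simpa only [map_mul, map_sum, map_pow, map_natCast] using this) (by omega) (by omega)
    have hev : Even (p - 1 - 6) :=
      (Nat.even_sub (by omega)).2 (iff_of_true (hp.out.even_sub_one (by omega)) (by decide))
    rw [hev.neg_one_pow, one_mul] at hb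
    rw [one_mul, coeff_prime_truncLog_pow 5, coeff_risingSum (by omega) (by decide) (by omega),
      show p - 2 - 5 = p - 1 - 6 by omega, hb, show p - 1 - 6 = p - 7 by omega]
    norm_num [Nat.factorial]

theorem dvd_of_toZMod_eq_zero {x : ℤ_[p]} (h : PadicInt.toZMod x = 0) : (p : ℤ_[p]) ∣ x := by
  rw [← RingHom.mem_ker, PadicInt.ker_toZMod, PadicInt.maximalIdeal_eq_span_p,
    Ideal.mem_span_singleton] at h
  exact h

theorem toZMod_padicS_one (n m : ℕ) :
    PadicInt.toZMod (padicS p n m 1) = (truncLog p ^ n).coeff (m * p) := by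
  rw [padicS, map_harmonicCoeff, ← harmonicPoly_one, harmonicCoeff, pow_one]
  congr 2
  refine harmonicPoly_congr (fun l hl => ?_) 1
  have := congrArg PadicInt.toZMod (padicInt_mul_inv l hl)
  rw [map_mul, map_natCast, map_one] at this
  exact eq_inv_of_mul_eq_one_right this

theorem exists_bernoulli_padicS_seven (h8 : 8 < p) : ∃ z : ℤ_[p],
    (z : ℚ_[p]) = (bernoulli (p - 7) : ℚ) ∧
      ∀ r, 1 ≤ r → (p : ℤ_[p]) ^ (r + 1) ∣ padicS p 7 1 (r + 1) - -504 * z * p ^ r := by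
  obtain ⟨z, hz, h1⟩ := exists_bernoulli_harmonic h8
  refine ⟨z, hz, fun r hr => ?_⟩
  induction r, hr using Nat.le_induction with
  | base =>
    have hf : IsUnit (((6).factorial : ℕ) : ℤ_[p]) :=
      isUnit_factorial_of_lt padicInt_mul_inv (by omega)
    have e1 := pow_dvd_factorial_mul_harmonicCoeff_sub hp.out (padicInt_mul_inv (p := p))
      (show 1 ≤ 7 by omega) (by omega) le_rfl (le_refl 1)
    obtain ⟨h2, h3⟩ := coeff_truncLog_pow_seven h8
    have h4 := coeff_truncLog_pow_sub (p := p) (n := 7) (a := 3) (by decide) (by omega)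
    have h5 := coeff_truncLog_pow_sub (p := p) (n := 7) (a := 2) (by decide) (by omega)
    have h6 := coeff_truncLog_pow_sub (p := p) (n := 7) (a := 1) (by decide) (by omega)
    -- With `s_1` the coefficient for `a = 1`, the symmetries give `2 (120 + 72 + 60) s_1 = 504
    -- s_1`, and `s_1 = -720 z` modulo `p`.
    have e2 : (p : ℤ_[p]) ∣ levelSum p (fun l => PadicInt.inv (l : ℤ_[p])) 7 1 -
        720 * (-504 * z) := by
      refine dvd_of_toZMod_eq_zero ?_
      have hl : levelSum p (fun l => PadicInt.inv (l : ℤ_[p])) 7 1 =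
          120 * padicS p 7 1 1 - 24 * padicS p 7 2 1 + 12 * padicS p 7 3 1 - 12 * padicS p 7 4 1 +
            24 * padicS p 7 5 1 - 120 * padicS p 7 6 1 := by
        have d1 : punctured 7 1 = 120 := by decide
        have d2 : punctured 7 2 = -24 := by decide
        have d3 : punctured 7 3 = 12 := by decide
        have d4 : punctured 7 4 = -12 := by decide
        have d5 : punctured 7 5 = 24 := by decide
        have d6 : punctured 7 6 = -120 := by decide
        rw [levelSum, Finset.sum_Ico_eq_sum_range]
        simp only [Finset.sum_range_succ, Finset.sum_range_zero, Nat.reduceAdd, Nat.reduceSub,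
          d1, d2, d3, d4, d5, d6, padicS]
        push_cast
        ring
      rw [hl]
      simp only [map_sub, map_add, map_mul, map_neg, map_ofNat, toZMod_padicS_one]
      simp only [Nat.reduceSub] at h4 h5 h6
      rw [h4, h5, h6, h2, h3, h1]
      ring
    have e3 := mul_dvd_mul_left (p : ℤ_[p]) e2
    rw [← sq] at e3
    rw [← hf.dvd_mul_left]
    convert dvd_add e1 e3 using 1
    rw [show levelCoeff 7 1 = 1 from levelCoeff_one 5, padicS]
    norm_num [Nat.factorial]
    ring
  | succ r hr ih =>
    have e1 := pow_dvd_harmonicCoeff_succ_sub_mul hp.out (padicInt_mul_inv (p := p))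
      (show 2 ≤ 7 by omega) (by omega) (show 2 ≤ r + 1 by omega)
    have e2 := mul_dvd_mul_left (p : ℤ_[p]) ih
    rw [← pow_succ'] at e2
    convert dvd_add e1 e2 using 1
    rw [padicS, padicS]
    ring

end

end

theorem mainTheorem2 :
    (∀ p r : ℕ, p.Prime → 7 < p → 1 ≤ r →
      CongrModPow p (r + 1) (S 7 1 p (r + 1))
        (-((Nat.factorial 7 : ℚ) / 10) * bernoulli (p - 7) * (p : ℚ) ^ r)) ∧
    (∀ n p r : ℕ, 1 ≤ n → p.Prime → n < p → 2 ≤ r →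
      CongrModPow p (r + 1) (S n 1 p (r + 1)) ((p : ℚ) * S n 1 p r)) := by
  refine ⟨fun p r hp h7 hr => ?_, fun n p r hn hp hnp hr => ?_⟩
  · have : Fact p.Prime := ⟨hp⟩
    -- The symmetry `X ↦ 1 - X` divides by `7 + 1`, hence needs `p > 8`.
    have h8 : 8 < p := lt_of_le_of_ne h7 (by rintro rfl; revert hp; decide)
    obtain ⟨z, hz, h⟩ := exists_bernoulli_padicS_seven h8
    refine congrModPow_of_dvd (coe_padicS 7 1 (r + 1)) ?_ (h r hr)
    rw [show -((Nat.factorial 7 : ℚ) / 10) = -504 by norm_num [Nat.factorial]]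
    have h504 : ((504 : ℤ_[p]) : ℚ_[p]) = 504 := PadicInt.coe_natCast 504
    push_cast
    rw [hz, h504]
  · have : Fact p.Prime := ⟨hp⟩
    refine congrModPow_of_dvd (coe_padicS n 1 (r + 1)) (y := p * padicS p n 1 r) ?_ ?_
    · push_cast
      rw [coe_padicS]
    -- For `n = 1` both sums are empty, since `l_1 = p^r` is excluded.
    · rcases hn.eq_or_lt with rfl | hn
      · rw [padicS, padicS, harmonicCoeff_eq_zero hp le_rfl (Or.inr le_rfl),
          harmonicCoeff_eq_zero hp le_rfl (Or.inr le_rfl), mul_zero, sub_zero]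
        exact dvd_zero _
      · exact pow_dvd_harmonicCoeff_succ_sub_mul hp padicInt_mul_inv hn hnp hr
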